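/- Let $p$ be a prime, let $k$ be a field of characteristic $p$, let $G$ be a finite $p$-group, and let $M$ be a $kG$-module (not assumed finitely generated). (1) If $H^0(G,M)$ is finite dimensional over $k$, then $M$ is finitely generated as a $kG$-module. (2) If the Tate cohomology group $\hat H^n(G,M)$ is finite dimensional over $k$ for some $n\in\mathbb Z$, then there are a finite dimensional $kG$-module $N$ and a projective $kG$-module $P$ with $M\cong N\oplus P$; hence $M$ is isomorphic to the finite dimensional module $N$ in the stable module category $\mathsf{StMod}(kG)$, whose objects are the $kG$-modules and whose morphisms are the $kG$-module homomorphisms modulo those that factor through a projective module. -/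

import Mathlib

open CategoryTheory
open scoped ZeroObject

universe u

/-- Two homomorphisms of `k G`-modules are stably equal if their difference factors
through a projective `k G`-module. -/
def stableHomRel (k G : Type u) [Field k] [Group G] : HomRel (Rep.{u} k G) :=
  fun M N f g => ∃ (P : Rep.{u} k G) (a : M ⟶ P) (b : P ⟶ N), Projective P ∧ f - g = a ≫ b

/-- Stable equality is an equivalence relation compatible with composition, so that the
morphisms of the quotient category below are literally `Hom(M, N) / PHom(M, N)`. -/
instance stableHomRel_congruence (k G : Type u) [Field k] [Group G] :
    Congruence (stableHomRel k G) where
  equivalence {M N} :=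
    { refl := fun f => ⟨0, 0, 0, inferInstance, by simp⟩
      symm := by
        rintro f g ⟨P, a, b, hP, h⟩
        exact ⟨P, -a, b, hP, by rw [Preadditive.neg_comp, ← h, neg_sub]⟩
      trans := by
        rintro f g l ⟨P, a, b, hP, h⟩ ⟨Q, c, d, hQ, h'⟩
        refine ⟨P ⊞ Q, Limits.biprod.lift a c, Limits.biprod.desc b d, inferInstance, ?_⟩
        rw [Limits.biprod.lift_desc, ← h, ← h', sub_add_sub_cancel] }
  comp_left := by
    rintro X Y Z f g g' ⟨P, a, b, hP, h⟩
    exact ⟨P, f ≫ a, b, hP, by rw [← Preadditive.comp_sub, h, Category.assoc]⟩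
  comp_right := by
    rintro X Y Z f f' g ⟨P, a, b, hP, h⟩
    exact ⟨P, a, b ≫ g, hP, by rw [← Preadditive.sub_comp, h, Category.assoc]⟩

/-- The stable module category `StMod(k G)`: its objects are all `k G`-modules, its morphisms
are homomorphisms modulo those that factor through a projective module. -/
abbrev StMod (k G : Type u) [Field k] [Group G] := CategoryTheory.Quotient (stableHomRel k G)

/-- The projection functor from `k G`-modules to the stable module category. -/
abbrev toStMod (k G : Type u) [Field k] [Group G] : Rep.{u} k G ⥤ StMod k G :=
  CategoryTheory.Quotient.functor (stableHomRel k G)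

/-! In characteristic `p` a `p`-group fixes a nonzero vector in every nonzero module, so a map
injective on invariants is injective. Extending a linear retraction `M → M^G` to a map `M → Fun(G,
M^G)` therefore embeds `M`, which gives (1).

For (2), degree 0 is decisive, since `Ĥ^0` is invariants modulo norms.
`Representation.exists_retraction_cofree_range_norm` splits off from `M` a copy of `Fun(G, norm M)`
containing every norm. The invariants of the complement meet the norms trivially, hence embed in
`Ĥ^0`; if that is finite dimensional, so is the complement, as in (1).

Other degrees reduce to 0 by dimension shifting through `Fun(G, M)`, which is projective with
vanishing Tate cohomology. By induction the shifted module is finite dimensional plus projective, so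
all its Tate cohomology is finite dimensional; shifting back, so is `Ĥ^0` of `M`. -/

namespace Representation

/-! ### Invariants of `p`-groups and modules of functions on `G` -/

variable {k G V W : Type*} [Field k] [Group G] [AddCommGroup V] [Module k V]
  [AddCommGroup W] [Module k W]

/-- A nonzero representation of a `p`-group in characteristic `p` has a nonzero invariant. -/
theorem exists_mem_invariants_ne_zero {p : ℕ} [Fact p.Prime] [CharP k p] [Finite G]
    (hG : IsPGroup p G) (ρ : Representation k G V) [Nontrivial V] :
    ∃ v ∈ ρ.invariants, v ≠ 0 := by
  obtain ⟨v, hv⟩ := exists_ne (0 : V)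
  have : Module (ZMod p) V := AddCommGroup.zmodModule fun x ↦ by
    rw [← Nat.cast_smul_eq_nsmul k, CharP.cast_eq_zero, zero_smul]
  -- Over the prime field the span of an orbit is a finite set, so fixed points can be counted
  -- modulo `p`; 0 is one, hence there is another.
  let S : Submodule (ZMod p) V := Submodule.span (ZMod p) (Set.range fun g ↦ ρ g v)
  have hS (g : G) (x : V) (hx : x ∈ S) : ρ g x ∈ S := by
    have hle : S ≤ S.comap ((ρ g).toAddMonoidHom.toZModLinearMap p) := by
      refine Submodule.span_le.2 ?_
      rintro _ ⟨h, rfl⟩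
      refine Submodule.subset_span ⟨g * h, ?_⟩
      simp
    exact hle hx
  let : MulAction G S :=
    { smul g x := ⟨ρ g x, hS g x x.2⟩
      one_smul x := Subtype.ext (by change ρ 1 (x : V) = x; simp)
      mul_smul g h x := Subtype.ext (by change ρ (g * h) (x : V) = ρ g (ρ h x); simp) }
  have hvS : v ∈ S := Submodule.subset_span ⟨1, by simp⟩
  have : Module.Finite (ZMod p) S := Module.Finite.span_of_finite _ (Set.finite_range _)
  have : Finite S := Module.finite_of_finite (ZMod p)
  have : Nontrivial S := ⟨⟨⟨v, hvS⟩, 0, fun h ↦ hv congr(($h : V))⟩⟩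
  have hdvd : p ∣ Nat.card S := by
    rw [Module.natCard_eq_pow_finrank (K := ZMod p), Nat.card_zmod]
    exact dvd_pow_self _ Module.finrank_pos.ne'
  obtain ⟨b, hb, hb0⟩ := hG.exists_fixed_point_of_prime_dvd_card_of_fixed_point S hdvd
    (a := 0) (fun g ↦ Subtype.ext (map_zero (ρ g)))
  exact ⟨b, fun g ↦ congr(($(hb g) : V)), fun h ↦ hb0 (Subtype.ext h.symm)⟩

/-- For a `p`-group in characteristic `p`, an intertwining map that is injective on invariants is
injective. -/
theorem IntertwiningMap.injective_of_invariants {p : ℕ} [Fact p.Prime] [CharP k p] [Finite G]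
    (hG : IsPGroup p G) {ρ : Representation k G V} {σ : Representation k G W}
    (f : ρ.IntertwiningMap σ) (hf : ∀ v ∈ ρ.invariants, f v = 0 → v = 0) :
    Function.Injective f := by
  refine (injective_iff_map_eq_zero f).2 fun v hv ↦ ?_
  by_contra hv0
  have : Nontrivial f.ker.toSubmodule := ⟨⟨⟨v, hv⟩, 0, fun h ↦ hv0 congr(($h : V))⟩⟩
  obtain ⟨w, hw, hw0⟩ := exists_mem_invariants_ne_zero hG f.ker.toRepresentation
  exact hw0 (Subtype.ext (hf w (fun g ↦ congr(($(hw g) : V))) w.2))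

variable (k G V) in
/-- The representation of `G` on functions `G → V` by right translation. -/
def cofree : Representation k G (G → V) where
  toFun g := LinearMap.funLeft k V (· * g)
  map_one' := by ext; simp
  map_mul' _ _ := by ext; simp [mul_assoc]

@[simp]
lemma cofree_apply (g : G) (f : G → V) (h : G) : cofree k G V g f h = f (h * g) := rfl

/-- The intertwining map to functions on `G` corresponding to a linear map. -/
def toCofree (ρ : Representation k G V) (r : V →ₗ[k] W) : ρ.IntertwiningMap (cofree k G W) where
  toLinearMap := LinearMap.pi fun g ↦ r ∘ₗ ρ g
  isIntertwining' g := by ext; simp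

@[simp]
lemma toCofree_apply (ρ : Representation k G V) (r : V →ₗ[k] W) (v : V) (g : G) :
    ρ.toCofree r v g = r (ρ g v) := rfl

/-- For a finite group, the intertwining map from functions on `G` corresponding to a
linear map. -/
def ofCofree [Fintype G] (ρ : Representation k G V) (s : W →ₗ[k] V) :
    (cofree k G W).IntertwiningMap ρ where
  toLinearMap := ∑ g : G, ρ g⁻¹ ∘ₗ s ∘ₗ LinearMap.proj g
  isIntertwining' g := by
    ext f : 1
    simp only [LinearMap.comp_apply, LinearMap.sum_apply, LinearMap.proj_apply, map_sum,
      cofree_apply]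
    refine Fintype.sum_bijective (· * g) (Group.mulRight_bijective g) _ _ fun h ↦ ?_
    simp [← Module.End.mul_apply, ← map_mul]

lemma ofCofree_apply [Fintype G] (ρ : Representation k G V) (s : W →ₗ[k] V) (f : G → W) :
    ρ.ofCofree s f = ∑ g : G, ρ g⁻¹ (s (f g)) := by
  change (∑ g : G, ρ g⁻¹ ∘ₗ s ∘ₗ LinearMap.proj g) f = _
  simp

lemma ofCofree_const [Fintype G] (ρ : Representation k G V) (s : W →ₗ[k] V) (w : W) :
    ρ.ofCofree s (fun _ ↦ w) = ρ.norm (s w) := by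
  rw [ofCofree_apply, norm, LinearMap.sum_apply]
  exact Fintype.sum_equiv (Equiv.inv G) _ _ fun _ ↦ rfl

/-- For a `p`-group in characteristic `p`, a representation with finite dimensional invariants is
finite dimensional. -/
theorem finiteDimensional_of_invariants {p : ℕ} [Fact p.Prime] [CharP k p] [Finite G]
    (hG : IsPGroup p G) (ρ : Representation k G V) [FiniteDimensional k ρ.invariants] :
    FiniteDimensional k V := by
  obtain ⟨r, hr⟩ := ρ.invariants.subtype.exists_leftInverse_of_injective
    (Submodule.ker_subtype _)
  have hinj : Function.Injective (ρ.toCofree r) :=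
    IntertwiningMap.injective_of_invariants hG _ fun v hv h ↦ by
      have h1 : r v = 0 := by simpa using congr_fun h 1
      have h2 : r v = ⟨v, hv⟩ := LinearMap.congr_fun hr ⟨v, hv⟩
      simpa using congr(($(h2.symm.trans h1) : V))
  exact FiniteDimensional.of_injective (ρ.toCofree r).toLinearMap hinj

/-- For a `p`-group in characteristic `p`, a space of functions on `G` that carries all norms splits
off, and the complement has no nonzero invariants that are norms. -/
theorem exists_retraction_cofree_range_norm {p : ℕ} [Fact p.Prime] [CharP k p] [Fintype G]
    (hG : IsPGroup p G) (ρ : Representation k G V) :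
    ∃ (i : (cofree k G (LinearMap.range ρ.norm)).IntertwiningMap ρ)
      (π : ρ.IntertwiningMap (cofree k G (LinearMap.range ρ.norm))),
      (∀ f, π (i f) = f) ∧ ∀ v ∈ LinearMap.range ρ.norm, π v = 0 → v = 0 := by
  obtain ⟨s, hs⟩ := ρ.norm.rangeRestrict.exists_rightInverse_of_surjective
    ρ.norm.range_rangeRestrict
  have hs' (v : LinearMap.range ρ.norm) : ρ.norm (s v) = v :=
    congr(($(LinearMap.congr_fun hs v) : V))
  let i := ρ.ofCofree s
  have hi : Function.Injective i := IntertwiningMap.injective_of_invariants hG _ fun f hf h ↦ by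
    have hc : f = fun _ ↦ f 1 := funext fun g ↦ by simpa using congr_fun (hf g) 1
    rw [hc, ofCofree_const, hs'] at h
    have h1 : f 1 = 0 := Subtype.ext h
    rw [hc, h1]
    rfl
  obtain ⟨l, hl⟩ := i.toLinearMap.exists_leftInverse_of_injective (LinearMap.ker_eq_bot.2 hi)
  have hl' (f) : l (i f) = f := LinearMap.congr_fun hl f
  -- Equivariance of `i` upgrades the merely linear retraction `l`: the value at `g` is `l (i (g •
  -- f))` at 1, that is `f g`.
  have hπ (f) : ρ.toCofree (LinearMap.proj 1 ∘ₗ l) (i f) = f := by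
    ext1 g
    rw [toCofree_apply, ← i.isIntertwining, LinearMap.comp_apply, hl']
    simp
  refine ⟨i, ρ.toCofree (LinearMap.proj 1 ∘ₗ l), hπ, fun v hv h ↦ ?_⟩
  -- A norm is the image under `i` of a constant function.
  have hv' : v = i fun _ ↦ ⟨v, hv⟩ := ((ρ.ofCofree_const s ⟨v, hv⟩).trans (hs' _)).symm
  rw [hv', hπ] at h
  exact congr(($(congr_fun h 1) : V))

end Representation

/-! ### Finiteness of homology of vector space complexes -/

/-- In a complex of vector spaces, a space of cycles that meets the boundaries trivially embeds
into the homology. -/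
theorem CategoryTheory.ShortComplex.finiteDimensional_of_disjoint_range {k : Type u} [Field k]
    (S : ShortComplex (ModuleCat.{u} k)) [FiniteDimensional k S.homology]
    (W : Submodule k S.X₂) (hker : W ≤ LinearMap.ker S.g.hom)
    (hW : Disjoint W (LinearMap.range S.f.hom)) : FiniteDimensional k W := by
  have : FiniteDimensional k S.moduleCatLeftHomologyData.H :=
    Module.Finite.equiv S.moduleCatHomologyIso.toLinearEquiv
  let L : W →ₗ[k] S.moduleCatLeftHomologyData.H :=
    (LinearMap.range S.moduleCatToCycles).mkQ ∘ₗ Submodule.inclusion hker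
  refine FiniteDimensional.of_injective L ((injective_iff_map_eq_zero L).2 fun w hw ↦ ?_)
  obtain ⟨x, hx⟩ := (Submodule.Quotient.mk_eq_zero _).1 hw
  exact Subtype.ext (Submodule.disjoint_def.1 hW w w.2 ⟨x, congr(($hx : S.X₂))⟩)

/-- A finite dimensional term of a complex of vector spaces has finite dimensional homology. -/
theorem CategoryTheory.ShortComplex.finiteDimensional_homology {k : Type u} [Field k]
    (S : ShortComplex (ModuleCat.{u} k)) [FiniteDimensional k S.X₂] :
    FiniteDimensional k S.homology := by
  have : FiniteDimensional k S.moduleCatLeftHomologyData.H :=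
    inferInstanceAs (FiniteDimensional k
      (LinearMap.ker S.g.hom ⧸ LinearMap.range S.moduleCatToCycles))
  exact Module.Finite.equiv S.moduleCatHomologyIso.symm.toLinearEquiv

/-! ### Functions on `G` as projective modules -/

namespace Rep

variable {k G : Type u} [Field k] [Group G]

/-- The `k G`-module of functions from `G` to a vector space. -/
abbrev cofree (k G : Type u) [Field k] [Group G] (V : Type u) [AddCommGroup V] [Module k V] :
    Rep.{u} k G :=
  Rep.of (Representation.cofree k G V)

/-- Functions on `G` are coinduced from the trivial subgroup. -/
noncomputable def cofreeIsoCoind (V : Type u) [AddCommGroup V] [Module k V] :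
    cofree k G V ≅ coind (⊥ : Subgroup G).subtype (trivial k (⊥ : Subgroup G) V) :=
  mkIso <| .mk
    { toFun f := ⟨f, fun g h ↦ by
        obtain rfl := Subsingleton.elim g 1
        simp⟩
      map_add' _ _ := rfl
      map_smul' _ _ := rfl
      invFun f := f.1
      left_inv _ := rfl
      right_inv _ := rfl } fun g ↦ rfl

variable [Fintype G]

/-- The projection onto the value at `1` has trace the identity of the functions on `G`. -/
lemma sum_cofree_single [DecidableEq G] {V : Type u} [AddCommGroup V] [Module k V] (f : G → V) :
    ∑ g : G, Representation.cofree k G V g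
      (Pi.single 1 (Representation.cofree k G V g⁻¹ f 1)) = f := by
  ext h
  rw [Finset.sum_apply, Finset.sum_eq_single h⁻¹]
  · simp
  · intro g _ hg
    rw [Representation.cofree_apply, Pi.single_eq_of_ne]
    exact fun h1 ↦ hg (eq_inv_of_mul_eq_one_right h1)
  · simp

instance projective_cofree (V : Type u) [AddCommGroup V] [Module k V] :
    Projective (cofree k G V) where
  factors {E X} f e he := by
    classical
    obtain ⟨s, hs⟩ := e.hom.toLinearMap.exists_rightInverse_of_surjective
      (LinearMap.range_eq_top.2 ((epi_iff_surjective e).1 he))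
    have hs' (x : X) : e.hom (s x) = x := LinearMap.congr_fun hs x
    -- Functions supported at 1 freely generate, so a linear lift there determines the equivariant
    -- one.
    let t : V →ₗ[k] E := s ∘ₗ f.hom.toLinearMap ∘ₗ LinearMap.single k (fun _ ↦ V) (1 : G)
    refine ⟨ofHom (σ := E.ρ) (E.ρ.ofCofree t), ?_⟩
    refine hom_ext (Representation.IntertwiningMap.ext (LinearMap.ext fun v : G → V ↦ ?_))
    change e.hom (E.ρ.ofCofree t v) = f.hom v
    conv_rhs => rw [← sum_cofree_single (k := k) v]
    rw [Representation.ofCofree_apply, map_sum, map_sum]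
    refine Fintype.sum_equiv (Equiv.inv G) _ _ fun g ↦ ?_
    rw [hom_comm_apply]
    change X.ρ g⁻¹ (e.hom (s (f.hom (Pi.single 1 (v g))))) = f.hom _
    rw [hs', ← hom_comm_apply]
    simp

/-- The embedding of a `k G`-module into the functions on `G`. -/
def toCofree (M : Rep.{u} k G) : M ⟶ cofree k G M :=
  ofHom (ρ := M.ρ) (M.ρ.toCofree LinearMap.id)

/-- The presentation of a `k G`-module as a quotient of the functions on `G`. -/
def ofCofree (M : Rep.{u} k G) : cofree k G M ⟶ M :=
  ofHom (σ := M.ρ) (M.ρ.ofCofree LinearMap.id)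

instance (M : Rep.{u} k G) : Mono M.toCofree :=
  (mono_iff_injective _).2 fun x y h ↦ by
    have h1 : M.ρ 1 x = M.ρ 1 y := congr_fun h 1
    simpa using h1

instance (M : Rep.{u} k G) : Epi M.ofCofree :=
  (epi_iff_surjective _).2 fun x ↦ by
    classical
    refine ⟨Pi.single 1 x, (M.ρ.ofCofree_apply _ _).trans ?_⟩
    rw [Finset.sum_eq_single 1] <;> simp +contextual

end Rep

/-! ### Vanishing of Tate cohomology on projectives -/

namespace TateCohomology

variable {k G : Type u} [Field k] [Group G] [Fintype G]

open Limits groupCohomology groupHomology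

lemma tateNorm_apply (M : Rep.{u} k G) (x : (inhomogeneousChains M).X 0) :
    M.tateNorm x = (cochainsIso₀ M).inv (M.ρ.norm ((chainsIso₀ M).hom x)) := rfl

omit [Fintype G] in
lemma d_cochainsIso₀_inv_eq_zero_iff (M : Rep.{u} k G) (x : M) :
    (inhomogeneousCochains M).d 0 1 ((cochainsIso₀ M).inv x) = 0 ↔ x ∈ M.ρ.invariants := by
  rw [← d₀₁_ker_eq_invariants, LinearMap.mem_ker]
  refine (congr_arg (· = 0) (eq_d₀₁_comp_inv_apply M x)).to_iff.trans ?_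
  exact map_eq_zero_iff _ ((ModuleCat.mono_iff_injective (cochainsIso₁ M).inv).1 inferInstance)

lemma isZero_zero_cofree (V : Type u) [AddCommGroup V] [Module k V] :
    IsZero (tateCohomology (Rep.cofree k G V) 0) := by
  classical
  refine HomologicalComplex.ExactAt.isZero_homology ?_
  rw [HomologicalComplex.exactAt_iff' _ (-1) 0 1 (by simp) (by simp),
    ShortComplex.moduleCat_exact_iff]
  intro (c : (inhomogeneousCochains (Rep.cofree k G V)).X 0)
    (hc : (inhomogeneousCochains (Rep.cofree k G V)).d 0 1 c = 0)
  obtain ⟨f, rfl⟩ : ∃ f : G → V, (cochainsIso₀ (Rep.cofree k G V)).inv f = c :=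
    ⟨(cochainsIso₀ (Rep.cofree k G V)).hom c, by simp⟩
  have hf := (d_cochainsIso₀_inv_eq_zero_iff (Rep.cofree k G V) f).1 hc
  -- An invariant function is constant, hence the norm of its restriction to 1.
  refine ⟨(chainsIso₀ (Rep.cofree k G V)).inv (Pi.single 1 (f 1) : G → V), ?_⟩
  refine (tateNorm_apply _ _).trans (congr_arg _ ?_)
  rw [Iso.inv_hom_id_apply]
  conv_rhs => rw [← Rep.sum_cofree_single (k := k) f]
  refine (LinearMap.sum_apply _ _ _).trans (Finset.sum_congr rfl fun g _ ↦ ?_)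
  rw [show Representation.cofree k G V g⁻¹ f = f from hf g⁻¹]

lemma isZero_neg_one_cofree (V : Type u) [AddCommGroup V] [Module k V] :
    IsZero (tateCohomology (Rep.cofree k G V) (-1)) := by
  classical
  refine HomologicalComplex.ExactAt.isZero_homology ?_
  rw [HomologicalComplex.exactAt_iff' _ (-2) (-1) 0 (by simp) (by simp),
    ShortComplex.moduleCat_exact_iff]
  intro (c : (inhomogeneousChains (Rep.cofree k G V)).X 0)
    (hc : (Rep.cofree k G V).tateNorm c = 0)
  obtain ⟨f, rfl⟩ : ∃ f : G → V, (chainsIso₀ (Rep.cofree k G V)).inv f = c :=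
    ⟨(chainsIso₀ (Rep.cofree k G V)).hom c, by simp⟩
  have hf : (Representation.cofree k G V).norm f = 0 := by
    rw [tateNorm_apply, Iso.inv_hom_id_apply] at hc
    exact (map_eq_zero_iff _ ((ModuleCat.mono_iff_injective
      (cochainsIso₀ (Rep.cofree k G V)).inv).1 inferInstance)).1 hc
  have hmem : f ∈ Representation.Coinvariants.ker (Representation.cofree k G V) := by
    -- Write `f = ∑ g • e_g` with each `e_g` supported at 1. The vanishing norm gives `∑ e_g = 0`,
    -- so `f = ∑ (g • e_g - e_g)` dies in the coinvariants.
    have hsum : ∑ g : G, (Pi.single 1 (Representation.cofree k G V g⁻¹ f 1) : G → V) = 0 := by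
      ext h
      rw [Finset.sum_apply]
      obtain rfl | hh := eq_or_ne h 1
      · have h1 := congr_fun hf 1
        rw [Representation.norm, LinearMap.sum_apply, Finset.sum_apply] at h1
        refine .trans (Fintype.sum_equiv (Equiv.inv G) _ _ fun g ↦ ?_) h1
        simp
      · exact Finset.sum_eq_zero fun g _ ↦ Pi.single_eq_of_ne hh _
    rw [← Rep.sum_cofree_single (k := k) f, ← sub_zero (∑ _, _), ← hsum, ← Finset.sum_sub_distrib]
    exact Submodule.sum_mem _ fun g _ ↦ Representation.Coinvariants.sub_mem_ker _ _
  rw [← range_d₁₀_eq_coinvariantsKer (Rep.cofree k G V)] at hmem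
  obtain ⟨y, rfl⟩ := hmem
  exact ⟨(chainsIso₁ _).inv y, eq_d₁₀_comp_inv_apply _ y⟩

/-- Outside degrees 0 and -1, Shapiro's lemma reduces to the trivial subgroup; for negative degrees,
induction and coinduction agree because `G` is finite. -/
theorem isZero_cofree (V : Type u) [AddCommGroup V] [Module k V] (n : ℤ) :
    IsZero (tateCohomology (Rep.cofree k G V) n) := by
  classical
  match n with
  | 0 => exact isZero_zero_cofree V
  | -1 => exact isZero_neg_one_cofree V
  | .ofNat (n + 1) =>
    refine .of_iso ?_ ((isoGroupCohomology (n + 1)).app _)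
    refine .of_iso ?_ ((groupCohomology.functor k G (n + 1)).mapIso (Rep.cofreeIsoCoind V))
    exact .of_iso (isZero_groupCohomology_succ_of_subsingleton _ n) (groupCohomology.coindIso _ _)
  | .negSucc (n + 1) =>
    refine .of_iso ?_ ((isoGroupHomology _ (n + 1) (Int.negSucc_eq _)).app _)
    refine .of_iso ?_ ((groupHomology.functor k G (n + 1)).mapIso
      (Rep.cofreeIsoCoind V ≪≫ (Rep.indCoindIso _).symm))
    exact .of_iso (isZero_groupHomology_succ_of_subsingleton _ n) (groupHomology.indIso _ _ _)

/-- A projective is a retract of a module of functions on `G`. -/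
theorem isZero_of_projective (P : Rep.{u} k G) [Projective P] (n : ℤ) :
    IsZero (tateCohomology P n) := by
  have h : (tateCohomologyFunctor n).map (Projective.factorThru (𝟙 P) P.ofCofree) ≫
      (tateCohomologyFunctor n).map P.ofCofree = 𝟙 _ := by
    rw [← Functor.map_comp, Projective.factorThru_comp, CategoryTheory.Functor.map_id]
  rw [IsZero.iff_id_eq_zero]
  refine h.symm.trans ?_
  rw [(isZero_cofree P n).eq_zero_of_tgt ((tateCohomologyFunctor n).map _), zero_comp]

end TateCohomology

/-! ### Finiteness of Tate cohomology and dimension shifting -/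

namespace TateCohomology

variable {k G : Type u} [Field k] [Group G] [Fintype G]

open Limits groupCohomology groupHomology

instance additive_tateCohomologyFunctor (n : ℤ) :
    (tateCohomologyFunctor (R := k) (G := G) n).Additive :=
  inferInstanceAs (tateComplexFunctor k G ⋙
    HomologicalComplex.homologyFunctor (ModuleCat k) (.up ℤ) n).Additive

instance finiteDimensional_tateComplex_X (M : Rep.{u} k G) [FiniteDimensional k M] (n : ℤ) :
    FiniteDimensional k ((tateComplex M).X n) :=
  match n with
  | .ofNat n => inferInstanceAs (FiniteDimensional k ((Fin n → G) → M))
  | .negSucc n => inferInstanceAs (FiniteDimensional k ((Fin n → G) →₀ M))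

instance finiteDimensional_of_finiteDimensional (M : Rep.{u} k G) [FiniteDimensional k M] (n : ℤ) :
    FiniteDimensional k (tateCohomology M n) :=
  have : FiniteDimensional k ((tateComplex M).sc n).X₂ := finiteDimensional_tateComplex_X M n
  ((tateComplex M).sc n).finiteDimensional_homology

lemma finiteDimensional_of_iso_biprod {M N P : Rep.{u} k G} (e : M ≅ N ⊞ P)
    [FiniteDimensional k N] [Projective P] (n : ℤ) :
    FiniteDimensional k (tateCohomology M n) := by
  let F := tateCohomologyFunctor (R := k) (G := G) n
  have h : F.map (e.hom ≫ biprod.fst) ≫ F.map (biprod.inl ≫ e.inv) = 𝟙 (F.obj M) := by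
    -- The composite through `N` differs from the identity by a map through `P`, which Tate
    -- cohomology kills.
    have h1 : (e.hom ≫ biprod.fst) ≫ biprod.inl ≫ e.inv =
        𝟙 M - (e.hom ≫ biprod.snd) ≫ biprod.inr ≫ e.inv := by
      rw [eq_sub_iff_add_eq, Category.assoc, Category.assoc, ← Preadditive.comp_add,
        ← Category.assoc biprod.fst, ← Category.assoc biprod.snd, ← Preadditive.add_comp,
        biprod.total, Category.id_comp, e.hom_inv_id]
    rw [← F.map_comp, h1, F.map_sub, F.map_comp, CategoryTheory.Functor.map_id,
      (isZero_of_projective P n).eq_zero_of_tgt (F.map (e.hom ≫ biprod.snd)), zero_comp, sub_zero]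
  refine FiniteDimensional.of_injective (F.map (e.hom ≫ biprod.fst)).hom
    (Function.LeftInverse.injective (g := F.map (biprod.inl ≫ e.inv)) fun x ↦ ?_)
  exact ConcreteCategory.congr_hom h x

lemma finiteDimensional_iff_of_shortExact {S : ShortComplex (Rep.{u} k G)} (hS : S.ShortExact)
    [Projective S.X₂] (n : ℤ) :
    FiniteDimensional k (tateCohomology S.X₃ n) ↔
      FiniteDimensional k (tateCohomology S.X₁ (n + 1)) := by
  have : IsIso (δ hS n) := (map_tateComplexFunctor_shortExact hS).isIso_δ n (n + 1) rfl
    (isZero_of_projective _ _) (isZero_of_projective _ _)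
  let e := (asIso (δ hS n)).toLinearEquiv
  exact ⟨fun _ ↦ Module.Finite.equiv e, fun _ ↦ Module.Finite.equiv e.symm⟩

lemma finiteDimensional_of_disjoint_range_norm (M : Rep.{u} k G)
    [h : FiniteDimensional k (tateCohomology M 0)] (W : Submodule k M) (hW : W ≤ M.ρ.invariants)
    (hd : Disjoint W (LinearMap.range M.ρ.norm)) : FiniteDimensional k W := by
  let S := (tateComplex M).sc' (-1) 0 1
  have : FiniteDimensional k ((tateComplex M).homology 0) := h
  have : FiniteDimensional k S.homology := Module.Finite.equiv
    ((tateComplex M).homologyIsoSc' (-1) 0 1 (by simp) (by simp)).toLinearEquiv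
  let e : M ≃ₗ[k] S.X₂ := (cochainsIso₀ M).symm.toLinearEquiv
  have : FiniteDimensional k (W.map e.toLinearMap) := by
    refine S.finiteDimensional_of_disjoint_range _ ?_ ?_
    · rintro _ ⟨w, hw, rfl⟩
      exact (d_cochainsIso₀_inv_eq_zero_iff M w).2 (hW hw)
    · rw [Submodule.disjoint_def]
      rintro _ ⟨w, hw, rfl⟩ ⟨x, hx⟩
      have h1 : M.ρ.norm ((chainsIso₀ M).hom x) = w := e.injective hx
      have h2 : w = 0 := Submodule.disjoint_def.1 hd w hw ⟨_, h1⟩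
      rw [h2, map_zero]
  exact Module.Finite.equiv (e.submoduleMap W).symm

end TateCohomology

/-! ### Splitting off a projective summand -/

namespace Rep

open Limits TateCohomology

variable {k G : Type u} [Field k] [Group G] [Fintype G] {p : ℕ} [Fact p.Prime] [CharP k p]

theorem exists_iso_biprod_of_tateCohomology_zero (hG : IsPGroup p G) (M : Rep.{u} k G)
    [FiniteDimensional k (tateCohomology M 0)] :
    ∃ N P : Rep.{u} k G, FiniteDimensional k N ∧ Projective P ∧ Nonempty (M ≅ N ⊞ P) := by
  obtain ⟨i, π, hπ, hd⟩ := M.ρ.exists_retraction_cofree_range_norm hG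
  let f : M ⟶ cofree k G (LinearMap.range M.ρ.norm) := ofHom (ρ := M.ρ) π
  let s : cofree k G (LinearMap.range M.ρ.norm) ⟶ M := ofHom (σ := M.ρ) i
  have hs : s ≫ f = 𝟙 _ :=
    hom_ext (Representation.IntertwiningMap.ext (LinearMap.ext fun v ↦ hπ v))
  let S := ShortComplex.mk (kernel.ι f) f (kernel.condition f)
  have hS : S.Exact := S.exact_of_f_is_kernel (kernelIsKernel f)
  have hW := finiteDimensional_of_disjoint_range_norm M
    (LinearMap.ker π.toLinearMap ⊓ M.ρ.invariants) inf_le_right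
    (Submodule.disjoint_def.2 fun v hv hv' ↦ hd v hv' hv.1)
  let L : (kernel f).ρ.invariants →ₗ[k] M :=
    (kernel.ι f).hom.toLinearMap ∘ₗ (kernel f).ρ.invariants.subtype
  have hL (v) : L v ∈ LinearMap.ker π.toLinearMap ⊓ M.ρ.invariants :=
    ⟨ConcreteCategory.congr_hom (kernel.condition f) v.1, fun g ↦ by
      refine (hom_comm_apply (kernel.ι f) g v.1).symm.trans ?_
      rw [v.2 g]
      rfl⟩
  have : FiniteDimensional k (kernel f).ρ.invariants := by
    refine FiniteDimensional.of_injective (L.codRestrict _ hL) fun v w h ↦ Subtype.ext ?_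
    exact (mono_iff_injective (kernel.ι f)).1 inferInstance congr(($h : M))
  exact ⟨kernel f, cofree k G (LinearMap.range M.ρ.norm),
    (kernel f).ρ.finiteDimensional_of_invariants hG, inferInstance,
    ⟨(ShortComplex.Splitting.ofExactOfSection S hS s hs inferInstance).isoBinaryBiproduct⟩⟩

theorem exists_iso_biprod_of_tateCohomology (hG : IsPGroup p G) (n : ℤ) (M : Rep.{u} k G)
    (hM : FiniteDimensional k (tateCohomology M n)) :
    ∃ N P : Rep.{u} k G, FiniteDimensional k N ∧ Projective P ∧ Nonempty (M ≅ N ⊞ P) := by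
  induction n generalizing M with
  | zero => exact exists_iso_biprod_of_tateCohomology_zero hG M
  | succ n ih =>
    let S := ShortComplex.mk M.toCofree (cokernel.π M.toCofree) (cokernel.condition _)
    have hS : S.ShortExact :=
      { exact := S.exact_of_g_is_cokernel (cokernelIsCokernel _)
        mono_f := inferInstanceAs (Mono M.toCofree)
        epi_g := inferInstanceAs (Epi (cokernel.π M.toCofree)) }
    have : Projective S.X₂ := projective_cofree M
    obtain ⟨N, P, hN, hP, ⟨e⟩⟩ := ih S.X₃ ((finiteDimensional_iff_of_shortExact hS n).2 hM)
    -- The decomposition of the cokernel is used only for its cohomology in degree -1, which shifts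
    -- to degree 0 of `M`.
    have : FiniteDimensional k (tateCohomology M (-1 + 1)) :=
      (finiteDimensional_iff_of_shortExact hS (-1)).1 (finiteDimensional_of_iso_biprod e _)
    rw [neg_add_cancel] at this
    exact exists_iso_biprod_of_tateCohomology_zero hG M
  | pred n ih =>
    let S := ShortComplex.mk (kernel.ι M.ofCofree) M.ofCofree (kernel.condition _)
    have hS : S.ShortExact :=
      { exact := S.exact_of_f_is_kernel (kernelIsKernel _)
        mono_f := inferInstanceAs (Mono (kernel.ι M.ofCofree))
        epi_g := inferInstanceAs (Epi M.ofCofree) }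
    have : Projective S.X₂ := projective_cofree M
    obtain ⟨N, P, hN, hP, ⟨e⟩⟩ := ih S.X₁ (by
      have := (finiteDimensional_iff_of_shortExact hS _).1 hM
      rwa [sub_add_cancel] at this)
    have : FiniteDimensional k (tateCohomology M 0) :=
      (finiteDimensional_iff_of_shortExact hS 0).2 (finiteDimensional_of_iso_biprod e _)
    exact exists_iso_biprod_of_tateCohomology_zero hG M

end Rep

/-! ### Passage to the stable category and conclusion -/

/-- Adding a projective module does not change the class in the stable module category. -/
noncomputable def StMod.isoOfIsoBiprod {k G : Type u} [Field k] [Group G] {M N P : Rep.{u} k G}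
    [Projective P] (e : M ≅ N ⊞ P) : (toStMod k G).obj M ≅ (toStMod k G).obj N :=
  (toStMod k G).mapIso e ≪≫
    { hom := (toStMod k G).map Limits.biprod.fst
      inv := (toStMod k G).map Limits.biprod.inl
      hom_inv_id := by
        rw [← CategoryTheory.Functor.map_comp, ← CategoryTheory.Functor.map_id]
        refine CategoryTheory.Quotient.sound _ ⟨P, -Limits.biprod.snd, Limits.biprod.inr, inferInstance, ?_⟩
        rw [← Limits.biprod.total, Preadditive.neg_comp]
        abel
      inv_hom_id := by
        rw [← CategoryTheory.Functor.map_comp, Limits.biprod.inl_fst, CategoryTheory.Functor.map_id] }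

theorem mainTheorem5 (p : ℕ) [Fact p.Prime] (k G : Type u) [Field k] [CharP k p]
    [Group G] [Fintype G] (hG : IsPGroup p G) (M : Rep.{u} k G) :
    (FiniteDimensional k (groupCohomology M 0) →
      Module.Finite (MonoidAlgebra k G) M.ρ.asModule) ∧
    (∀ n : ℤ, FiniteDimensional k (tateCohomology M n) →
      ∃ N P : Rep.{u} k G, FiniteDimensional k N ∧ Projective P ∧
        Nonempty (M ≅ N ⊞ P) ∧ Nonempty ((toStMod k G).obj M ≅ (toStMod k G).obj N)) := by
  refine ⟨fun _ ↦ ?_, fun n hn ↦ ?_⟩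
  · have : FiniteDimensional k M.ρ.invariants :=
      Module.Finite.equiv (groupCohomology.H0Iso M).toLinearEquiv
    have : FiniteDimensional k M := M.ρ.finiteDimensional_of_invariants hG
    have : Module.Finite k M.ρ.asModule := Module.Finite.equiv M.ρ.asModuleEquiv.symm
    exact Module.Finite.of_restrictScalars_finite k _ _
  · obtain ⟨N, P, hN, hP, ⟨e⟩⟩ := Rep.exists_iso_biprod_of_tateCohomology hG n M hn
    exact ⟨N, P, hN, hP, ⟨e⟩, ⟨StMod.isoOfIsoBiprod e⟩⟩
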